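/- For real constants $a,b,c,d,e$ let $T(n)$, $n\ge 0$, be the sequence defined by the single initial value $T(0)=1$ and the recurrence $$(n+1)^3T(n+1)=(2n+1)(an^2+an+b)\,T(n)+n(cn^2+d)\,T(n-1)+e\,n(2n-1)(n-1)\,T(n-2)\qquad(n\ge 0),$$ in which the coefficient of $T(n-1)$ vanishes for $n=0$ and the coefficient of $T(n-2)$ vanishes for $n=0,1$, so that no further initial values are needed. Write $T_{14A},T_{14B},T_{14C},T_{14\overline C}$ for the sequences obtained for the following values of $(a,b,c,d,e)$: $$\begin{array}{ll} T_{14A}: & (3,\;1,\;47,\;4,\;14),\\ T_{14B}: & (11,\;5,\;-121,\;-20,\;98),\\ T_{14C}: & (8\sqrt2-7,\;4\sqrt2-4,\;168\sqrt2-205,\;32\sqrt2-43,\;28(11\sqrt2-16)),\\ T_{14\overline C}: & (-8\sqrt2-7,\;-4\sqrt2-4,\;-168\sqrt2-205,\;-32\sqrt2-43,\;-28(11\sqrt2+16)). \end{array}$$ Theorem. For all complex $w$ in some neighborhood of $w=0$ the following four series converge absolutely and have the same sum: $$\begin{aligned} \sum_{n=0}^\infty T_{14A}(n)\left(\frac{w}{1+5w+8w^2}\right)^{n+1}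 &=\sum_{n=0}^\infty T_{14B}(n)\left(\frac{w}{1+9w+8w^2}\right)^{n+1}\\ &=\sum_{n=0}^\infty T_{14C}(n)\left(\frac{w}{1+\sqrt{32}\,w+8w^2}\right)^{n+1}\\ &=\sum_{n=0}^\infty T_{14\overline C}(n)\left(\frac{w}{1-\sqrt{32}\,w+8w^2}\right)^{n+1}. \end{aligned}$$ -/

import Mathlib

/-- The sequence with `T 0 = 1` and, for all `n ≥ 0`,
`(n+1)^3 T(n+1) = (2n+1)(a n^2 + a n + b) T(n) + n (c n^2 + d) T(n-1)
  + e n (2n-1)(n-1) T(n-2)`.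
The coefficient of `T(n-1)` vanishes for `n = 0` and that of `T(n-2)` for `n = 0` and `n = 1`, so
the single value `T 0 = 1` starts the recurrence; the clauses for `1` and `2` are its instances
`n = 0` and `n = 1`. -/
noncomputable def fourTermSeq (a b c d e : ℝ) : ℕ → ℝ
  | 0 => 1
  | 1 => b
  | 2 => (3 * (2 * a + b) * fourTermSeq a b c d e 1 + (c + d) * fourTermSeq a b c d e 0) / 8
  | k + 3 =>
    let n : ℝ := (k : ℝ) + 2
    ((2 * n + 1) * (a * n ^ 2 + a * n + b) * fourTermSeq a b c d e (k + 2)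
      + n * (c * n ^ 2 + d) * fourTermSeq a b c d e (k + 1)
      + e * n * (2 * n - 1) * (n - 1) * fourTermSeq a b c d e k) / (n + 1) ^ 3

theorem fourTermSeq_zero (a b c d e : ℝ) : fourTermSeq a b c d e 0 = 1 := by
  rw [fourTermSeq]

/-- The recurrence holds for every `n`; the values of `T` at the truncated indices are
multiplied by `0`. -/
theorem fourTermSeq_rec (a b c d e : ℝ) (n : ℕ) :
    ((n : ℝ) + 1) ^ 3 * fourTermSeq a b c d e (n + 1) =
      (2 * (n : ℝ) + 1) * (a * (n : ℝ) ^ 2 + a * n + b) * fourTermSeq a b c d e n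
      + n * (c * (n : ℝ) ^ 2 + d) * fourTermSeq a b c d e (n - 1)
      + e * n * (2 * (n : ℝ) - 1) * ((n : ℝ) - 1) * fourTermSeq a b c d e (n - 2) := by
  match n with
  | 0 => simp [fourTermSeq]
  | 1 => simp [fourTermSeq]; ring
  | k + 2 =>
    have h : ((k : ℝ) + 2 + 1) ^ 3 ≠ 0 := by positivity
    rw [show k + 2 + 1 = k + 3 from rfl, fourTermSeq]
    simp only [Nat.add_sub_cancel, show k + 2 - 1 = k + 1 from rfl]
    push_cast
    rw [mul_div_cancel₀ _ h]

/-- The sequence attached to `ε = 5`. -/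
noncomputable def T14A : ℕ → ℝ := fourTermSeq 3 1 47 4 14

/-- The sequence attached to `ε = 9`. -/
noncomputable def T14B : ℕ → ℝ := fourTermSeq 11 5 (-121) (-20) 98

/-- The sequence attached to `ε = √32`. -/
noncomputable def T14C : ℕ → ℝ :=
  fourTermSeq (8 * √2 - 7) (4 * √2 - 4) (168 * √2 - 205) (32 * √2 - 43) (28 * (11 * √2 - 16))

/-- The sequence attached to `ε = -√32`, the conjugate of `T14C`. -/
noncomputable def T14Cbar : ℕ → ℝ :=
  fourTermSeq (-8 * √2 - 7) (-4 * √2 - 4) (-168 * √2 - 205) (-32 * √2 - 43)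
    (-28 * (11 * √2 + 16))

/-! All four sequences are shifted moments of one functional: `T n = L ((u + ε) ^ n)` with `ε = 5,
9, ±√32`. Formally `∑ T n * x ^ (n + 1) = L (1 / (1 / x - ε - u))`, and for `x = w / (1 + ε w + 8 w
^ 2)` the quantity `1 / x - ε = 1 / w + 8 w` does not depend on `ε`. `L` is defined by its moments,
chosen so that it kills the image of a third-order operator with leading coefficient `P`. Applying
the operator to `(u + ε) ^ n` gives five terms in general. The lowest has coefficient `P (-ε) n (n -
1) (n - 2)`, so it drops out when `P (-ε) = 0`, leaving the four-term recurrence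
(`momentOperator_X_add_C_pow`). Convergence and the change of variable come from
`hasSum_binomial_transform`. -/

open Polynomial in
/-- The third-order differential operator on polynomials whose leading coefficient is
`(X + 5) (X + 9) (X ^ 2 - 32)` and which annihilates the common moment functional. -/
noncomputable def momentOperator (p : ℝ[X]) : ℝ[X] :=
  (X ^ 4 + 14 * X ^ 3 + 13 * X ^ 2 - 448 * X - 1440) * derivative (derivative (derivative p))
    + (6 * X ^ 3 + 63 * X ^ 2 + 39 * X - 672) * derivative (derivative p)
    + (7 * X ^ 2 + 50 * X + 24) * derivative p + (X + 4) * p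

/-- The moments of the functional annihilated by `momentOperator`, with `momentSeq 0 = 1`. -/
noncomputable def momentSeq : ℕ → ℝ
  | 0 => 1
  | m + 1 =>
    -((14 * (m * (m - 1) * (m - 2) : ℝ) + 63 * (m * (m - 1)) + 50 * m + 4) * momentSeq m
      + (13 * (m * (m - 1) * (m - 2) : ℝ) + 39 * (m * (m - 1)) + 24 * m) * momentSeq (m - 1)
      - (448 * (m * (m - 1) * (m - 2) : ℝ) + 672 * (m * (m - 1))) * momentSeq (m - 2)
      - 1440 * (m * (m - 1) * (m - 2) : ℝ) * momentSeq (m - 3)) / (m + 1) ^ 3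
  decreasing_by all_goals omega

theorem momentSeq_zero : momentSeq 0 = 1 := by rw [momentSeq]

theorem momentSeq_rec (m : ℕ) :
    ((m : ℝ) + 1) ^ 3 * momentSeq (m + 1) =
    -((14 * (m * (m - 1) * (m - 2) : ℝ) + 63 * (m * (m - 1)) + 50 * m + 4) * momentSeq m
      + (13 * (m * (m - 1) * (m - 2) : ℝ) + 39 * (m * (m - 1)) + 24 * m) * momentSeq (m - 1)
      - (448 * (m * (m - 1) * (m - 2) : ℝ) + 672 * (m * (m - 1))) * momentSeq (m - 2)
      - 1440 * (m * (m - 1) * (m - 2) : ℝ) * momentSeq (m - 3)) := by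
  have h : ((m : ℝ) + 1) ^ 3 ≠ 0 := by positivity
  rw [momentSeq, mul_div_cancel₀ _ h]

/-! ### Growth of the moments -/

theorem abs_momentSeq_le (m : ℕ) : |momentSeq m| ≤ 3000 ^ m := by
  induction m using Nat.strong_induction_on with
  | _ m ih =>
    match m with
    | 0 => simp [momentSeq_zero]
    | m + 1 =>
      have bound : ∀ i, |momentSeq (m - i)| ≤ 3000 ^ m := fun i =>
        (ih (m - i) (by omega)).trans (pow_le_pow_right₀ (by norm_num) (by omega))
      have hm : (0 : ℝ) ≤ m := by positivity
      have h2 : (0 : ℝ) ≤ m * (m - 1) := by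
        rcases m with _ | m
        · simp
        · push_cast; ring_nf; positivity
      have h3 : (0 : ℝ) ≤ m * (m - 1) * (m - 2) := by
        rcases m with _ | _ | m
        · simp
        · simp
        · push_cast; ring_nf; positivity
      have hp : (0 : ℝ) < ((m : ℝ) + 1) ^ 3 := by positivity
      have key : ∀ c s : ℝ, 0 ≤ c → |s| ≤ 3000 ^ m → |c * s| ≤ c * 3000 ^ m := by
        intro c s hc hs
        rw [abs_mul, abs_of_nonneg hc]
        exact mul_le_mul_of_nonneg_left hs hc
      have e0 := key (14 * (m * (m - 1) * (m - 2) : ℝ) + 63 * (m * (m - 1)) + 50 * m + 4) _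
        (by positivity) (bound 0)
      have e1 := key (13 * (m * (m - 1) * (m - 2) : ℝ) + 39 * (m * (m - 1)) + 24 * m) _
        (by positivity) (bound 1)
      have e2 := key (448 * (m * (m - 1) * (m - 2) : ℝ) + 672 * (m * (m - 1))) _
        (by positivity) (bound 2)
      have e3 := key (1440 * (m * (m - 1) * (m - 2) : ℝ)) _ (by positivity) (bound 3)
      -- The left side sums the absolute values of all coefficients in the recurrence, e.g. `1915 =
      -- 14 + 13 + 448 + 1440`; any constant dominating it would do for `3000`.
      have coeff : 1915 * (m * (m - 1) * (m - 2) : ℝ) + 774 * (m * (m - 1)) + 74 * m + 4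
          ≤ 3000 * ((m : ℝ) + 1) ^ 3 := by
        have := pow_nonneg hm 2
        have := pow_nonneg hm 3
        nlinarith
      have tot := mul_le_mul_of_nonneg_right coeff (by positivity : (0 : ℝ) ≤ 3000 ^ m)
      have hrec := momentSeq_rec m
      refine le_of_mul_le_mul_left ?_ hp
      rw [show ((m : ℝ) + 1) ^ 3 * |momentSeq (m + 1)| = |((m : ℝ) + 1) ^ 3 * momentSeq (m + 1)| by
        rw [abs_mul, abs_of_pos hp], hrec, pow_succ (3000 : ℝ) m]
      rw [Nat.sub_zero] at e0
      rw [abs_le] at *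
      constructor <;> linarith

/-! ### The functional and its shifted moments -/

open Polynomial in
/-- The linear functional on polynomials with moments `momentSeq`. -/
noncomputable def momentFunctional : ℝ[X] →ₗ[ℝ] ℝ :=
  (Polynomial.basisMonomials ℝ).constr ℝ momentSeq

open Polynomial in
theorem momentFunctional_X_pow (m : ℕ) : momentFunctional (X ^ m) = momentSeq m := by
  have := (Polynomial.basisMonomials ℝ).constr_basis ℝ momentSeq m
  simpa [momentFunctional, X_pow_eq_monomial] using this

open Polynomial in
-- Truncated exponents are harmless: their coefficients contain a vanishing falling factorial of
-- `m`.
theorem momentOperator_X_pow (m : ℕ) :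
    momentOperator (X ^ m) = ((m : ℝ) + 1) ^ 3 • X ^ (m + 1)
      + (14 * (m * (m - 1) * (m - 2) : ℝ) + 63 * (m * (m - 1)) + 50 * m + 4) • X ^ m
      + (13 * (m * (m - 1) * (m - 2) : ℝ) + 39 * (m * (m - 1)) + 24 * m) • X ^ (m - 1)
      - (448 * (m * (m - 1) * (m - 2) : ℝ) + 672 * (m * (m - 1))) • X ^ (m - 2)
      - (1440 * (m * (m - 1) * (m - 2) : ℝ)) • X ^ (m - 3) := by
  match m with
  | 0 => simp [momentOperator, smul_eq_C_mul, map_ofNat]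
  | 1 => simp [momentOperator, smul_eq_C_mul, map_ofNat]; ring
  | 2 => simp [momentOperator, smul_eq_C_mul, map_ofNat]; ring
  | k + 3 =>
    simp [momentOperator, smul_eq_C_mul, map_ofNat]
    ring

open Polynomial in
theorem momentFunctional_momentOperator (p : ℝ[X]) :
    momentFunctional (momentOperator p) = 0 := by
  induction p using Polynomial.induction_on' with
  | add p q hp hq =>
    have : momentOperator (p + q) = momentOperator p + momentOperator q := by
      simp only [momentOperator, derivative_add]; ring
    rw [this, map_add, hp, hq, add_zero]
  | monomial n a =>
    have : momentOperator (monomial n a) = a • momentOperator (X ^ n) := by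
      rw [← smul_X_eq_monomial]
      simp only [momentOperator, derivative_smul, mul_smul_comm, smul_add]
    rw [this, map_smul, momentOperator_X_pow]
    simp only [map_add, map_sub, map_smul, momentFunctional_X_pow, smul_eq_mul]
    rw [momentSeq_rec]
    ring

open Polynomial in
-- Taylor expansion of the operator's coefficients at `-ε`. The second-order coefficient is `(3 / 2)
-- P'`, which produces the factor `n (2 n - 1) (n - 1)` and the constant `-P' (-ε) / 2` in the last
-- term.
theorem momentOperator_X_add_C_pow {ε : ℝ} (hε : (5 - ε) * (9 - ε) * (ε ^ 2 - 32) = 0) (n : ℕ) :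
    momentOperator ((X + C ε) ^ n) = ((n : ℝ) + 1) ^ 3 • (X + C ε) ^ (n + 1)
      - ((2 * (n : ℝ) + 1) * ((2 * ε - 7) * (n : ℝ) ^ 2 + (2 * ε - 7) * n + (ε - 4))) •
        (X + C ε) ^ n
      - (n * ((-6 * ε ^ 2 + 42 * ε - 13) * (n : ℝ) ^ 2 + (-ε ^ 2 + 8 * ε - 11))) •
        (X + C ε) ^ (n - 1)
      - ((2 * ε ^ 3 - 21 * ε ^ 2 + 13 * ε + 224) * n * (2 * (n : ℝ) - 1) * ((n : ℝ) - 1)) •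
        (X + C ε) ^ (n - 2) := by
  -- This is `P (-ε) = 0`, solved for the top power.
  have hC : (C ε : ℝ[X]) ^ 4 = 14 * C ε ^ 3 - 13 * C ε ^ 2 - 448 * C ε + 1440 := by
    have h : ε ^ 4 = 14 * ε ^ 3 - 13 * ε ^ 2 - 448 * ε + 1440 := by linear_combination hε
    rw [← C_pow, h]
    simp [map_ofNat]
  obtain ⟨Y, hY⟩ : ∃ Y : ℝ[X], Y = X + C ε := ⟨_, rfl⟩
  have hX : (X : ℝ[X]) = Y - C ε := by rw [hY]; ring
  have hd : derivative Y = 1 := by simp [hY]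
  rw [← hY]
  match n with
  | 0 => simp [momentOperator, smul_eq_C_mul, map_ofNat, hX]; ring
  | 1 => simp [momentOperator, smul_eq_C_mul, map_ofNat, hX, hd]; ring
  | 2 =>
    simp [momentOperator, smul_eq_C_mul, map_ofNat, derivative_pow, hX, hd]
    ring
  | k + 3 =>
    simp [momentOperator, smul_eq_C_mul, map_ofNat, derivative_pow, hX, hd]
    linear_combination (exp := 1) ((k + 3 : ℝ[X]) * (k + 2) * (k + 1) * Y ^ k) * hC

open Polynomial in
/-- The sequence attached to a root `-ε` of `(u + 5) (u + 9) (u ^ 2 - 32)` is the sequence of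
shifted moments. -/
theorem fourTermSeq_eq_momentFunctional {ε : ℝ}
    (hε : (5 - ε) * (9 - ε) * (ε ^ 2 - 32) = 0) (n : ℕ) :
    fourTermSeq (2 * ε - 7) (ε - 4) (-6 * ε ^ 2 + 42 * ε - 13) (-ε ^ 2 + 8 * ε - 11)
      (2 * ε ^ 3 - 21 * ε ^ 2 + 13 * ε + 224) n = momentFunctional ((X + C ε) ^ n) := by
  induction n using Nat.strong_induction_on with
  | _ n ih =>
    match n with
    | 0 =>
      rw [fourTermSeq_zero, pow_zero, ← pow_zero X, momentFunctional_X_pow, momentSeq_zero]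
    | n + 1 =>
      have hp : ((n : ℝ) + 1) ^ 3 ≠ 0 := by positivity
      have h := momentFunctional_momentOperator ((X + C ε) ^ n)
      rw [momentOperator_X_add_C_pow hε] at h
      simp only [map_sub, map_smul, smul_eq_mul] at h
      refine mul_left_cancel₀ hp ?_
      rw [fourTermSeq_rec, ih n (by omega), ih (n - 1) (by omega), ih (n - 2) (by omega)]
      linear_combination -h

open Polynomial in
theorem fourTermSeq_eq_sum_momentSeq {ε : ℝ}
    (hε : (5 - ε) * (9 - ε) * (ε ^ 2 - 32) = 0) (n : ℕ) :
    fourTermSeq (2 * ε - 7) (ε - 4) (-6 * ε ^ 2 + 42 * ε - 13) (-ε ^ 2 + 8 * ε - 11)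
      (2 * ε ^ 3 - 21 * ε ^ 2 + 13 * ε + 224) n =
      ∑ kj ∈ Finset.HasAntidiagonal.antidiagonal n, (n.choose kj.1 : ℝ) * ε ^ kj.2 * momentSeq kj.1 := by
  rw [fourTermSeq_eq_momentFunctional hε, (Commute.all X (C ε)).add_pow', map_sum]
  refine Finset.sum_congr rfl fun kj _ => ?_
  have : n.choose kj.1 • (X ^ kj.1 * C ε ^ kj.2) =
      ((n.choose kj.1 : ℝ) * ε ^ kj.2) • (X : ℝ[X]) ^ kj.1 := by
    rw [smul_eq_C_mul, nsmul_eq_mul]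
    simp
    ring
  rw [this, map_smul, momentFunctional_X_pow, smul_eq_mul]

/-! ### Generating functions -/

/-- Binomial transforms of generating functions: absolute convergence and change of variable. -/
theorem hasSum_binomial_transform {S : ℕ → ℂ} {R : ℝ} (hR : 0 ≤ R) (hS : ∀ k, ‖S k‖ ≤ R ^ k)
    {ε x : ℂ} (hx : ‖x‖ * (R + ‖ε‖) < 1) (hx' : ‖ε * x‖ < 1) :
    HasSum (fun n : ℕ => (∑ kj ∈ Finset.HasAntidiagonal.antidiagonal n,
        (n.choose kj.1 : ℂ) * ε ^ kj.2 * S kj.1) * x ^ (n + 1))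
      (∑' k : ℕ, S k * (x / (1 - ε * x)) ^ (k + 1)) := by
  -- Summing this double series along antidiagonals gives the left side; summing over the second
  -- index first gives the right side, by the negative binomial series.
  set f : ℕ × ℕ → ℂ := fun kj =>
    S kj.1 * x ^ (kj.1 + 1) * ((kj.2 + kj.1).choose kj.1 * (ε * x) ^ kj.2) with hf
  have fiber : ∀ n, ∀ kj ∈ Finset.HasAntidiagonal.antidiagonal n,
      f kj = (n.choose kj.1 : ℂ) * ε ^ kj.2 * S kj.1 * x ^ (n + 1) := by
    intro n kj h
    rw [Finset.HasAntidiagonal.mem_antidiagonal] at h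
    simp only [hf]
    rw [← h, add_comm kj.2 kj.1]
    ring
  have hsum : Summable f := by
    rw [← (Finset.HasAntidiagonal.sigmaAntidiagonalEquivProd (A := ℕ)).summable_iff]
    refine Summable.of_norm ?_
    refine (summable_sigma_of_nonneg fun _ => norm_nonneg _).2
      ⟨fun n => (hasSum_fintype _).summable, ?_⟩
    -- By the binomial theorem, the norms on the `n`-th antidiagonal add up to at most this term.
    have geo : Summable fun n : ℕ => ‖x‖ * (‖x‖ * (R + ‖ε‖)) ^ n :=
      (summable_geometric_of_lt_one (by positivity) hx).mul_left _
    refine Summable.of_nonneg_of_le (fun n => tsum_nonneg fun _ => norm_nonneg _) (fun n => ?_) geo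
    rw [tsum_fintype]
    calc _ = ∑ kj ∈ Finset.HasAntidiagonal.antidiagonal n, ‖f kj‖ :=
          Finset.sum_coe_sort (Finset.HasAntidiagonal.antidiagonal n) fun kj => ‖f kj‖
      _ ≤ ∑ kj ∈ Finset.HasAntidiagonal.antidiagonal n, ‖x‖ ^ (n + 1) * n.choose kj.1 • (R ^ kj.1 * ‖ε‖ ^ kj.2) := by
          refine Finset.sum_le_sum fun kj h => ?_
          rw [fiber n kj h]
          simp only [norm_mul, norm_pow, Complex.norm_natCast, nsmul_eq_mul]
          calc _ = ‖x‖ ^ (n + 1) * (n.choose kj.1 * (‖S kj.1‖ * ‖ε‖ ^ kj.2)) := by ring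
            _ ≤ _ := by gcongr; exact hS _
      _ = ‖x‖ * (‖x‖ * (R + ‖ε‖)) ^ n := by
          rw [← Finset.mul_sum, ← (Commute.all R ‖ε‖).add_pow', mul_pow]
          ring
  have h1 : HasSum (fun n : ℕ => (∑ kj ∈ Finset.HasAntidiagonal.antidiagonal n,
        (n.choose kj.1 : ℂ) * ε ^ kj.2 * S kj.1) * x ^ (n + 1)) (∑' kj, f kj) := by
    have := ((Finset.HasAntidiagonal.sigmaAntidiagonalEquivProd (A := ℕ)).hasSum_iff.2 hsum.hasSum).sigma
      (fun n => hasSum_fintype _)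
    refine this.congr_fun fun n => ?_
    rw [Finset.sum_mul]
    exact ((Finset.sum_coe_sort (Finset.HasAntidiagonal.antidiagonal n) f).trans
      (Finset.sum_congr rfl (fiber n))).symm
  have h2 : HasSum (fun k : ℕ => S k * (x / (1 - ε * x)) ^ (k + 1)) (∑' kj, f kj) := by
    refine hsum.hasSum.prod_fiberwise fun k => ?_
    have := (hasSum_choose_mul_geometric_of_norm_lt_one k hx').mul_left (S k * x ^ (k + 1))
    rwa [show S k * x ^ (k + 1) * (1 / (1 - ε * x) ^ (k + 1)) =
      S k * (x / (1 - ε * x)) ^ (k + 1) by rw [div_pow]; ring] at this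
  rwa [h2.tsum_eq]

/-- The point is that the sum is free of `ε`: the substitution `x / (1 - ε x)` cancels the term `ε
w` in the denominator. -/
theorem hasSum_fourTermSeq {ε : ℝ} (hε : (5 - ε) * (9 - ε) * (ε ^ 2 - 32) = 0) :
    ∀ᶠ w : ℂ in nhds 0, HasSum (fun n : ℕ =>
      (fourTermSeq (2 * ε - 7) (ε - 4) (-6 * ε ^ 2 + 42 * ε - 13) (-ε ^ 2 + 8 * ε - 11)
        (2 * ε ^ 3 - 21 * ε ^ 2 + 13 * ε + 224) n : ℂ) *
          (w / (1 + (ε : ℂ) * w + 8 * w ^ 2)) ^ (n + 1))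
      (∑' k : ℕ, (momentSeq k : ℂ) * (w / (1 + 8 * w ^ 2)) ^ (k + 1)) := by
  have hc : ContinuousAt (fun w : ℂ => w / (1 + (ε : ℂ) * w + 8 * w ^ 2)) 0 :=
    ContinuousAt.div (by fun_prop) (by fun_prop) (by simp)
  have small : ∀ᶠ w : ℂ in nhds 0,
      ‖w / (1 + (ε : ℂ) * w + 8 * w ^ 2)‖ * (3000 + ‖(ε : ℂ)‖) < 1 :=
    (hc.norm.mul continuousAt_const).eventually_lt continuousAt_const (by simp)
  have small' : ∀ᶠ w : ℂ in nhds 0,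
      ‖(ε : ℂ) * (w / (1 + (ε : ℂ) * w + 8 * w ^ 2))‖ < 1 :=
    (continuousAt_const.mul hc).norm.eventually_lt continuousAt_const (by simp)
  have ne : ∀ᶠ w : ℂ in nhds 0, 1 + (ε : ℂ) * w + 8 * w ^ 2 ≠ 0 :=
    ContinuousAt.eventually_ne (by fun_prop) (by simp)
  have ne' : ∀ᶠ w : ℂ in nhds 0, 1 + 8 * w ^ 2 ≠ 0 :=
    ContinuousAt.eventually_ne (by fun_prop) (by simp)
  filter_upwards [small, small', ne, ne'] with w h1 h2 h3 h4
  have hS : ∀ k, ‖(momentSeq k : ℂ)‖ ≤ 3000 ^ k := fun k => by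
    rw [Complex.norm_real]; exact abs_momentSeq_le k
  have h := hasSum_binomial_transform (by norm_num) hS h1 h2
  have hv : w / (1 + (ε : ℂ) * w + 8 * w ^ 2) /
      (1 - ε * (w / (1 + (ε : ℂ) * w + 8 * w ^ 2))) = w / (1 + 8 * w ^ 2) := by
    have : 1 - ε * (w / (1 + (ε : ℂ) * w + 8 * w ^ 2)) =
        (1 + 8 * w ^ 2) / (1 + (ε : ℂ) * w + 8 * w ^ 2) := by
      rw [eq_div_iff h3, sub_mul, mul_assoc, div_mul_cancel₀ _ h3]; ring
    rw [this, div_div_div_cancel_right₀ h3]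
  rw [hv] at h
  convert h using 4 with n
  rw [fourTermSeq_eq_sum_momentSeq hε]
  push_cast
  rfl

theorem mainTheorem6 :
    ∀ᶠ w : ℂ in nhds 0, ∃ S : ℂ,
      HasSum (fun n : ℕ => (T14A n : ℂ) * (w / (1 + 5 * w + 8 * w ^ 2)) ^ (n + 1)) S ∧
      HasSum (fun n : ℕ => (T14B n : ℂ) * (w / (1 + 9 * w + 8 * w ^ 2)) ^ (n + 1)) S ∧
      HasSum (fun n : ℕ =>
        (T14C n : ℂ) * (w / (1 + ((√32 : ℝ) : ℂ) * w + 8 * w ^ 2)) ^ (n + 1)) S ∧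
      HasSum (fun n : ℕ =>
        (T14Cbar n : ℂ) * (w / (1 - ((√32 : ℝ) : ℂ) * w + 8 * w ^ 2)) ^ (n + 1)) S := by
  have h32 : √(32 : ℝ) = 4 * √2 := by
    rw [show (32 : ℝ) = 4 ^ 2 * 2 by norm_num, Real.sqrt_mul (by norm_num),
      Real.sqrt_sq (by norm_num)]
  have hsq : (√32 : ℝ) ^ 2 = 32 := Real.sq_sqrt (by norm_num)
  have hA := hasSum_fourTermSeq (ε := 5) (by norm_num)
  have hB := hasSum_fourTermSeq (ε := 9) (by norm_num)
  have hC := hasSum_fourTermSeq (ε := √32) (by rw [hsq]; ring)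
  have hD := hasSum_fourTermSeq (ε := -√32) (by rw [neg_sq, hsq]; ring)
  have eA : T14A = fourTermSeq (2 * 5 - 7) (5 - 4) (-6 * 5 ^ 2 + 42 * 5 - 13) (-5 ^ 2 + 8 * 5 - 11)
      (2 * 5 ^ 3 - 21 * 5 ^ 2 + 13 * 5 + 224) := by rw [T14A]; norm_num
  have eB : T14B = fourTermSeq (2 * 9 - 7) (9 - 4) (-6 * 9 ^ 2 + 42 * 9 - 13) (-9 ^ 2 + 8 * 9 - 11)
      (2 * 9 ^ 3 - 21 * 9 ^ 2 + 13 * 9 + 224) := by rw [T14B]; norm_num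
  have eC : T14C = fourTermSeq (2 * √32 - 7) (√32 - 4) (-6 * √32 ^ 2 + 42 * √32 - 13)
      (-√32 ^ 2 + 8 * √32 - 11) (2 * √32 ^ 3 - 21 * √32 ^ 2 + 13 * √32 + 224) := by
    rw [T14C, pow_succ √32 2, hsq, h32]; congr 1 <;> ring
  have eD : T14Cbar = fourTermSeq (2 * -√32 - 7) (-√32 - 4) (-6 * (-√32) ^ 2 + 42 * -√32 - 13)
      (-(-√32) ^ 2 + 8 * -√32 - 11) (2 * (-√32) ^ 3 - 21 * (-√32) ^ 2 + 13 * -√32 + 224) := by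
    rw [T14Cbar, pow_succ (-√32) 2, neg_sq, hsq, h32]; congr 1 <;> ring
  filter_upwards [hA, hB, hC, hD] with w hA hB hC hD
  rw [← eA] at hA
  rw [← eB] at hB
  rw [← eC] at hC
  rw [← eD] at hD
  refine ⟨_, ?_, ?_, hC, ?_⟩
  · simpa using hA
  · simpa using hB
  · simpa [sub_eq_add_neg] using hD
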